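/- All alphabets are finite and ranked. $T_\Sigma$ is the set of ground trees over $\Sigma$, and $T_\Sigma[V]$ the set of trees over $\Sigma$ whose leaves may also be labeled by elements of $V$; $X=\{x_1,x_2,\dots\}$, $X_k=\{x_1,\dots,x_k\}$ and $Q(X_k)=\{q(x_i)\mid q\in Q,\ i\le k\}$. A pattern in $T_\Sigma\{X_k\}$ is a ground tree, or a tree in $T_\Sigma[X_k]$ that contains each of $x_1,\dots,x_k$ exactly once and in this order. A context is a non-ground pattern in $T_\Sigma\{X_1\}$. A tree $t\in T_\Sigma[X_k]$ is a prefix of $t'$ if $t'$ is obtained from $t$ by substituting trees for the variables, and $\bigsqcup M$ is the maximal pattern that is a prefix of every tree in $M$. A total deterministic top-down tree transducer $T$ with input alphabet $\Sigma$ and output alphabet $\Delta$ consists of a finite set $Q$ of states, an axiom $A\in T_\Delta[Q(X_1)]$, and, for each $q\in Q$ and each $a\in\Sigma$ of rank $k$, exactly one rule $q(a(x_1,\dots,x_k))\to\mathrm{rhs}(q,a)$ with $\mathrm{rhs}(q,a)\in T_\Delta[Q(X_k)]$. It is linear if every variable occurs at most once in the axiom and in each right-hand side. For $s\in T_\Sigma[X]$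 put $[\![q]\!](x)=q(x)$ for $x\in X$, let $[\![q]\!](a(s_1,\dots,s_k))$ be $\mathrm{rhs}(q,a)$ with every leaf $q'(x_i)$ replaced by $[\![q']\!](s_i)$, and let $T(s)$ be $A$ with every leaf $q(x_1)$ replaced by $[\![q]\!](s)$. Two transducers with the same input and output alphabets are equivalent if they define the same function on $T_\Sigma$. $T$ is canonical earliest if $\bigsqcup\{[\![q]\!](s)\mid s\in T_\Sigma\}=x_1$ for every $q\in Q$, and for all distinct $q_1,q_2\in Q$ there is $s\in T_\Sigma$ with $[\![q_1]\!](s)\ne[\![q_2]\!](s)$. States $q_1,q_2$ (possibly equal) occur pairwise in $T$ if for some context $c$ there are distinct nodes of $T(c)$ labeled $q_1(x_1)$ and $q_2(x_1)$. $T$ is zero output twinned if for all pairwise occurring $q_1,q_2$ there is no context $c\ne x_1$ such that $q_1(x_1)$ occurs in $[\![q_1]\!](c)$, $q_2(x_1)$ occurs in $[\![q_2]\!](c)$, and $[\![q_1]\!](c)\ne q_1(x_1)$ or $[\![q_2]\!](c)\neq q_2(x_1)$. $T$ is lca-conform if for every $k$, every pattern $s\in T_\Sigma\{X_k\}$ and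 every $i\le k$ such that $T(s)$ has a leaf with a label of the form $q(x_i)$, the subtree of $T(s)$ rooted at the lowest common ancestor of all these leaves contains no leaf with a label of the form $q(x_j)$, $j\ne i$. Theorem. Let $T$ be a total deterministic top-down tree transducer that is canonical earliest. There is a linear total deterministic top-down tree transducer equivalent to $T$ if and only if $T$ is zero output twinned and lca-conform. -/

import Mathlib

/-- `VTree ar V` is the set `T_Σ[V]` of trees over the ranked alphabet `Σ` (symbols `S`, rank
function `ar`), where the elements of `V` may additionally label leaves. -/
inductive VTree {S : Type*} (ar : S → ℕ) (V : Type*) where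
  | leaf (v : V) : VTree ar V
  | node (a : S) (ts : Fin (ar a) → VTree ar V) : VTree ar V

/-- The set `T_Σ` of ground trees. -/
abbrev GroundTree {S : Type*} (ar : S → ℕ) := VTree ar Empty

namespace VTree

/-- Substitution: every leaf `v ∈ V` is replaced by the tree `σ v`. -/
def subst {S V W : Type*} {ar : S → ℕ} (σ : V → VTree ar W) : VTree ar V → VTree ar W
  | leaf v => σ v
  | node a ts => node a (fun i => (ts i).subst σ)

/-- The labels in `V` of the leaves of a tree, listed from left to right. -/
def vars {S V : Type*} {ar : S → ℕ} : VTree ar V → List V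
  | leaf v => [v]
  | node a ts => (List.finRange (ar a)).flatMap (fun i => (ts i).vars)

/-- The subtree `t/u` at the node `u`. Nodes are strings of child indices (counted from `0`);
the value is `none` if `u` is not a node of `t`. -/
def sub {S V : Type*} {ar : S → ℕ} : VTree ar V → List ℕ → Option (VTree ar V)
  | t, [] => some t
  | leaf _, _ :: _ => none
  | node a ts, i :: u => if h : i < ar a then (ts ⟨i, h⟩).sub u else none

/-- The node `u` of `t` is a leaf that is labeled by `v ∈ V`. -/
def LeafAt {S V : Type*} {ar : S → ℕ} (t : VTree ar V) (u : List ℕ) (v : V) : Prop :=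
  t.sub u = some (leaf v)

/-- No leaf is labeled by an element of `V`. -/
def IsGround {S V : Type*} {ar : S → ℕ} (t : VTree ar V) : Prop := t.vars = []

/-- The set `T_Σ{X_k}` of patterns: the ground trees, and the trees that contain each of the
`k` variables exactly once and in order. -/
def IsPattern {S : Type*} {ar : S → ℕ} {k : ℕ} (t : VTree ar (Fin k)) : Prop :=
  t.IsGround ∨ t.vars = List.finRange k

/-- A context is a non-ground pattern in `T_Σ{X_1}`. -/
def IsContext {S : Type*} {ar : S → ℕ} (c : VTree ar (Fin 1)) : Prop :=
  c.IsPattern ∧ ¬ c.IsGround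

/-- `t ∈ T_Σ[X_k]` is a prefix of `t'` if `t[t_1, …, t_k] = t'` for some trees `t_1, …, t_k`. -/
def IsPrefixOf {S W : Type*} {ar : S → ℕ} {k : ℕ} (t : VTree ar (Fin k)) (t' : VTree ar W) : Prop :=
  ∃ σ : Fin k → VTree ar W, t.subst σ = t'

/-- `p = ⨆ M`: the pattern `p` is a prefix of all trees in `M`, and it is the maximal such
pattern: every pattern that is a prefix of all trees in `M` is a prefix of `p`. -/
def IsMaxCommonPrefix {S W : Type*} {ar : S → ℕ} {k : ℕ} (M : Set (VTree ar W))
    (p : VTree ar (Fin k)) : Prop :=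
  p.IsPattern ∧ (∀ t ∈ M, p.IsPrefixOf t) ∧
    ∀ (n : ℕ) (p' : VTree ar (Fin n)), p'.IsPattern → (∀ t ∈ M, p'.IsPrefixOf t) → p'.IsPrefixOf p

end VTree

/-- `v` is the lowest common ancestor, i.e. the longest common prefix, of the nonempty set `N`
of nodes. -/
def IsLowestCommonAncestor (N : Set (List ℕ)) (v : List ℕ) : Prop :=
  N.Nonempty ∧ (∀ u ∈ N, v <+: u) ∧ ∀ w : List ℕ, (∀ u ∈ N, w <+: u) → w <+: v

/-- A deterministic total top-down tree transducer with set of states `Q`, input alphabet `arS`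
and output alphabet `arD`. A leaf `(q, i)` stands for the label `q(x_{i+1})`. -/
structure Transducer (Q : Type*) {S D : Type*} (arS : S → ℕ) (arD : D → ℕ) where
  /-- The axiom, an element of `T_Δ[Q(X_1)]`. -/
  init : VTree arD (Q × Fin 1)
  /-- The right-hand side of the unique rule for `q` and `a`, an element of `T_Δ[Q(X_k)]`
  where `k` is the rank of `a`. -/
  rhs : Q → (a : S) → VTree arD (Q × Fin (arS a))

namespace Transducer

open VTree

/-- The function of the state `q` from `T_Σ[V]` to `T_Δ[Q(V)]`. -/
def stateEval {Q S D V : Type*} {arS : S → ℕ} {arD : D → ℕ} (T : Transducer Q arS arD) :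
    VTree arS V → Q → VTree arD (Q × V)
  | leaf v, q => leaf (q, v)
  | node a ts, q => (T.rhs q a).subst (fun p => T.stateEval (ts p.2) p.1)

/-- The function of the transducer from `T_Σ[V]` to `T_Δ[Q(V)]`. -/
def eval {Q S D V : Type*} {arS : S → ℕ} {arD : D → ℕ} (T : Transducer Q arS arD)
    (s : VTree arS V) : VTree arD (Q × V) :=
  T.init.subst (fun p => T.stateEval s p.1)

/-- The output, a ground tree, of the transducer on a ground input tree. -/
def output {Q S D : Type*} {arS : S → ℕ} {arD : D → ℕ} (T : Transducer Q arS arD)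
    (s : GroundTree arS) : GroundTree arD :=
  (T.eval s).subst (fun p => p.2.elim)

/-- Equivalence: equality of the functions on ground input trees. -/
def Equivalent {Q Q' S D : Type*} {arS : S → ℕ} {arD : D → ℕ} (T : Transducer Q arS arD)
    (T' : Transducer Q' arS arD) : Prop :=
  ∀ s : GroundTree arS, T.output s = T'.output s

/-- In the axiom and in each right-hand side, every variable occurs at most once. -/
def IsLinear {Q S D : Type*} {arS : S → ℕ} {arD : D → ℕ} (T : Transducer Q arS arD) : Prop :=
  (T.init.vars.map Prod.snd).Nodup ∧ ∀ q a, ((T.rhs q a).vars.map Prod.snd).Nodup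

/-- Earliest: for every state `q`, the maximal common prefix of all outputs of `q` on ground
trees is the variable `x_1`. -/
def IsEarliest {Q S D : Type*} {arS : S → ℕ} {arD : D → ℕ} (T : Transducer Q arS arD) : Prop :=
  ∀ q, IsMaxCommonPrefix (Set.range (fun s : GroundTree arS => T.stateEval s q))
    (leaf 0 : VTree arD (Fin 1))

/-- Canonical earliest: earliest, and distinct states are inequivalent. -/
def IsCanonicalEarliest {Q S D : Type*} {arS : S → ℕ} {arD : D → ℕ}
    (T : Transducer Q arS arD) : Prop :=
  T.IsEarliest ∧ ∀ q₁ q₂, q₁ ≠ q₂ → ∃ s : GroundTree arS, T.stateEval s q₁ ≠ T.stateEval s q₂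

/-- `q₁` and `q₂` (possibly equal) occur pairwise in `T`: at distinct nodes of `T(c)`, for some
context `c`. -/
def OccurPairwise {Q S D : Type*} {arS : S → ℕ} {arD : D → ℕ} (T : Transducer Q arS arD)
    (q₁ q₂ : Q) : Prop :=
  ∃ c : VTree arS (Fin 1), c.IsContext ∧ ∃ v₁ v₂ : List ℕ, v₁ ≠ v₂ ∧
    (T.eval c).LeafAt v₁ (q₁, 0) ∧ (T.eval c).LeafAt v₂ (q₂, 0)

/-- `(q₁, q₂) ⊢^c (q₁', q₂')`. -/
def OutputStep {Q S D : Type*} {arS : S → ℕ} {arD : D → ℕ} (T : Transducer Q arS arD)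
    (c : VTree arS (Fin 1)) (q₁ q₂ q₁' q₂' : Q) : Prop :=
  (∃ v, (T.stateEval c q₁).LeafAt v (q₁', 0)) ∧ (∃ v, (T.stateEval c q₂).LeafAt v (q₂', 0)) ∧
    (T.stateEval c q₁ ≠ leaf (q₁', 0) ∨ T.stateEval c q₂ ≠ leaf (q₂', 0))

/-- Zero output twinned: no pairwise occurring states have loops on a common context of which
at least one generates output. -/
def ZeroOutputTwinned {Q S D : Type*} {arS : S → ℕ} {arD : D → ℕ}
    (T : Transducer Q arS arD) : Prop :=
  ∀ q₁ q₂, T.OccurPairwise q₁ q₂ →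
    ¬ ∃ c : VTree arS (Fin 1), c.IsContext ∧ c ≠ leaf 0 ∧ T.OutputStep c q₁ q₂ q₁ q₂

/-- `v = ν_T(s, x_i)`: the lowest common ancestor of all leaves of `T(s)` with a label of the
form `q(x_i)`. -/
def IsNu {Q S D : Type*} {arS : S → ℕ} {arD : D → ℕ} {k : ℕ} (T : Transducer Q arS arD)
    (s : VTree arS (Fin k)) (i : Fin k) (v : List ℕ) : Prop :=
  IsLowestCommonAncestor {u | ∃ q, (T.eval s).LeafAt u (q, i)} v

/-- Lca-conform: for every pattern `s`, if `v = ν_T(s, x_i)` is defined, then no leaf with a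
label of the form `q(x_j)`, `j ≠ i`, occurs in `T(s)/v`. -/
def LcaConform {Q S D : Type*} {arS : S → ℕ} {arD : D → ℕ} (T : Transducer Q arS arD) : Prop :=
  ∀ (k : ℕ) (s : VTree arS (Fin k)), s.IsPattern →
    ∀ (i : Fin k) (v : List ℕ), T.IsNu s i v →
      ∀ t, (T.eval s).sub v = some t →
        ¬ ∃ (w : List ℕ) (q : Q) (j : Fin k), j ≠ i ∧ t.LeafAt w (q, j)

end Transducer

/-!
**Necessity.** In an earliest transducer `T` the root symbol of the output of a state is not
constant (`IsEarliest.exists_ne_node`). Hence, if `T'` is equivalent to `T`, the output `T'(s)` on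
a tree with variables is a prefix of `T(s)`: every leaf `q(x_i)` of `T(s)` lies at or below a leaf
`q'(x_i)` of `T'(s)`, and the subtree of `T(s)` at that node has no variable other than `x_i`
(`IsEarliest.exists_leafAt_prefix`). If `T'` is linear, there is only one such leaf for each `x_i`,
which gives lca-conformity. As `T` is canonical, the subtree of `T(s)` at that node is moreover
determined by `q'` (`IsCanonicalEarliest.eq_of_instantiate_eq`), so its height is bounded. A loop
with output for two pairwise occurring states could be pumped to exceed this bound.

**Sufficiency.** The states of the linear transducer are the *delays* of `T`: the trees
`T(c)/ν`, where `c` follows a path in the input and `ν` is the lowest common ancestor of the leaves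
that process the end of the path. When the next input symbol is read, lca-conformity ensures that
the new tree splits, for each child `x_i` of the input node, into at most one subtree that contains
all leaves `q(x_i)` and no other variables (`Separated.exists_linear`); these subtrees are delays
again. There are finitely many delays because their height is bounded
(`ZeroOutputTwinned.finite_delays`): the root of a delay, unless it is a leaf, has two children
that contain variables, so each state below the root has a companion with which it occurs
pairwise and which survives to the end of the path. As `T` is zero output twinned, the
number of pairs of states that are reachable with output from such a pair decreases whenever output is generated
(`ZeroOutputTwinned.height_stateEval_le`).
-/

/-! ### Substitution, nodes and subtrees -/

namespace VTree

variable {S V W X : Type*} {ar : S → ℕ}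

@[simp] theorem subst_leaf (σ : V → VTree ar W) (v : V) : (leaf v).subst σ = σ v := rfl

@[simp] theorem subst_node (σ : V → VTree ar W) (a : S) (ts : Fin (ar a) → VTree ar V) :
    (node a ts).subst σ = node a (fun i => (ts i).subst σ) := rfl

@[simp] theorem vars_leaf (v : V) : (leaf v : VTree ar V).vars = [v] := rfl

theorem vars_node (a : S) (ts : Fin (ar a) → VTree ar V) :
    (node a ts).vars = (List.finRange (ar a)).flatMap (fun i => (ts i).vars) := rfl

@[simp] theorem mem_vars_node {a : S} {ts : Fin (ar a) → VTree ar V} {v : V} :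
    v ∈ (node a ts).vars ↔ ∃ i, v ∈ (ts i).vars := by
  simp [vars_node, List.mem_flatMap]

@[simp] theorem sub_nil (t : VTree ar V) : t.sub [] = some t := by cases t <;> rfl

@[simp] theorem sub_leaf_cons (v : V) (i : ℕ) (u : List ℕ) :
    (leaf v : VTree ar V).sub (i :: u) = none := rfl

theorem sub_node_cons (a : S) (ts : Fin (ar a) → VTree ar V) (i : ℕ) (u : List ℕ) :
    (node a ts).sub (i :: u) = if h : i < ar a then (ts ⟨i, h⟩).sub u else none := rfl

@[simp] theorem sub_node_fin (a : S) (ts : Fin (ar a) → VTree ar V) (i : Fin (ar a))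
    (u : List ℕ) : (node a ts).sub (i.val :: u) = (ts i).sub u := by
  simp [sub_node_cons]

theorem sub_node_cons_eq_some {a : S} {ts : Fin (ar a) → VTree ar V} {i : ℕ} {u : List ℕ}
    {b : VTree ar V} (h : (node a ts).sub (i :: u) = some b) :
    ∃ j : Fin (ar a), i = j.val ∧ (ts j).sub u = some b := by
  rw [sub_node_cons] at h
  split at h
  · rename_i hi
    exact ⟨⟨i, hi⟩, rfl, h⟩
  · simp at h

theorem sub_append (t : VTree ar V) (u w : List ℕ) :
    t.sub (u ++ w) = (t.sub u).bind (fun b => b.sub w) := by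
  induction u generalizing t with
  | nil => simp
  | cons i u ih =>
    cases t with
    | leaf v => simp
    | node a ts =>
      simp only [List.cons_append, sub_node_cons]
      split
      · exact ih _
      · simp

theorem subst_subst (t : VTree ar V) (σ : V → VTree ar W) (τ : W → VTree ar X) :
    (t.subst σ).subst τ = t.subst (fun v => (σ v).subst τ) := by
  induction t with
  | leaf v => rfl
  | node a ts ih => simp [ih]

@[simp] theorem subst_id (t : VTree ar V) : t.subst leaf = t := by
  induction t with
  | leaf v => rfl
  | node a ts ih => simp [ih]

theorem subst_eq_subst_iff (t : VTree ar V) (σ τ : V → VTree ar W) :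
    t.subst σ = t.subst τ ↔ ∀ v ∈ t.vars, σ v = τ v := by
  induction t with
  | leaf v => simp
  | node a ts ih =>
    simp only [subst_node, node.injEq, heq_eq_eq, true_and, funext_iff, ih, mem_vars_node]
    exact ⟨fun h v ⟨i, hi⟩ => h i v hi, fun h i v hi => h v ⟨i, hi⟩⟩

theorem vars_subst (t : VTree ar V) (σ : V → VTree ar W) :
    (t.subst σ).vars = t.vars.flatMap (fun v => (σ v).vars) := by
  induction t with
  | leaf v => simp
  | node a ts ih => simp [vars_node, ih, List.flatMap_assoc]

theorem mem_vars_subst {t : VTree ar V} {σ : V → VTree ar W} {w : W} :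
    w ∈ (t.subst σ).vars ↔ ∃ v ∈ t.vars, w ∈ (σ v).vars := by
  simp [vars_subst, List.mem_flatMap]

theorem mem_vars_iff_leafAt {t : VTree ar V} {v : V} : v ∈ t.vars ↔ ∃ u, t.LeafAt u v := by
  induction t with
  | leaf w =>
    constructor
    · intro h
      obtain rfl : v = w := by simpa using h
      exact ⟨[], by simp [LeafAt]⟩
    · rintro ⟨_ | ⟨i, u⟩, h⟩
      · simp only [LeafAt, sub_nil, Option.some.injEq, leaf.injEq] at h
        simp [h]
      · simp [LeafAt] at h
  | node a ts ih =>
    rw [mem_vars_node]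
    constructor
    · rintro ⟨i, hi⟩
      obtain ⟨u, hu⟩ := (ih i).1 hi
      exact ⟨i.val :: u, by simpa [LeafAt] using hu⟩
    · rintro ⟨_ | ⟨i, u⟩, h⟩
      · simp [LeafAt] at h
      · obtain ⟨j, -, hj⟩ := sub_node_cons_eq_some h
        exact ⟨j, (ih j).2 ⟨u, hj⟩⟩

theorem sub_subst {t b : VTree ar V} {u : List ℕ} (h : t.sub u = some b) (σ : V → VTree ar W) :
    (t.subst σ).sub u = some (b.subst σ) := by
  induction u generalizing t with
  | nil => simp_all
  | cons i u ih =>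
    cases t with
    | leaf v => simp at h
    | node a ts =>
      obtain ⟨j, rfl, hj⟩ := sub_node_cons_eq_some h
      simpa using ih hj

theorem sub_append_of_sub {t b : VTree ar V} {u : List ℕ} (h : t.sub u = some b) (w : List ℕ) :
    t.sub (u ++ w) = b.sub w := by
  simp [sub_append, h]

theorem LeafAt.subst {t : VTree ar V} {u w : List ℕ} {v : V} {x : W} {σ : V → VTree ar W}
    (h : t.LeafAt u v) (hw : (σ v).LeafAt w x) : (t.subst σ).LeafAt (u ++ w) x := by
  unfold LeafAt
  rw [sub_append_of_sub (sub_subst h σ)]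
  exact hw

/-- Leaves are incomparable: no extension of a leaf is another node. -/
theorem LeafAt.eq_of_prefix {t b : VTree ar V} {u w : List ℕ} {v : V} (h : t.LeafAt u v)
    (hb : t.sub w = some b) (huw : u <+: w) : u = w := by
  obtain ⟨x, rfl⟩ := huw
  rw [sub_append_of_sub h] at hb
  cases x with
  | nil => simp
  | cons i x => simp at hb

theorem LeafAt.append_ne_append {t : VTree ar V} {u u' : List ℕ} {v v' : V} (h : t.LeafAt u v)
    (h' : t.LeafAt u' v') (hne : u ≠ u') (w w' : List ℕ) : u ++ w ≠ u' ++ w' := by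
  intro he
  rcases List.prefix_or_prefix_of_prefix (List.prefix_append u w)
    (he ▸ List.prefix_append u' w') with hp | hp
  · exact hne (h.eq_of_prefix h' hp)
  · exact hne (h'.eq_of_prefix h hp).symm

/-- `b.IsSubtree t`: the tree `b` is the subtree of `t` at some node. -/
def IsSubtree (b t : VTree ar V) : Prop := ∃ u, t.sub u = some b

theorem IsSubtree.refl (t : VTree ar V) : t.IsSubtree t := ⟨[], by simp⟩

theorem IsSubtree.trans {r s t : VTree ar V} (h : r.IsSubtree s) (h' : s.IsSubtree t) :
    r.IsSubtree t := by
  obtain ⟨u, hu⟩ := h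
  obtain ⟨w, hw⟩ := h'
  exact ⟨w ++ u, by rw [sub_append_of_sub hw, hu]⟩

theorem IsSubtree.child {a : S} (ts : Fin (ar a) → VTree ar V) (i : Fin (ar a)) :
    (ts i).IsSubtree (node a ts) := ⟨[i.val], by simp⟩

theorem isSubtree_leaf {b : VTree ar V} {v : V} : b.IsSubtree (leaf v) ↔ b = leaf v := by
  constructor
  · rintro ⟨_ | ⟨i, u⟩, h⟩
    · simpa using h.symm
    · simp at h
  · rintro rfl
    exact .refl _

theorem isSubtree_node {b : VTree ar V} {a : S} {ts : Fin (ar a) → VTree ar V} :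
    b.IsSubtree (node a ts) ↔ b = node a ts ∨ ∃ i, b.IsSubtree (ts i) := by
  constructor
  · rintro ⟨_ | ⟨i, u⟩, h⟩
    · exact .inl (by simpa using h.symm)
    · obtain ⟨j, -, hj⟩ := sub_node_cons_eq_some h
      exact .inr ⟨j, u, hj⟩
  · rintro (rfl | ⟨i, h⟩)
    · exact .refl _
    · exact h.trans (.child ts i)

theorem leaf_isSubtree_iff {t : VTree ar V} {v : V} : (leaf v).IsSubtree t ↔ v ∈ t.vars :=
  mem_vars_iff_leafAt.symm

theorem IsSubtree.vars_subset {b t : VTree ar V} (h : b.IsSubtree t) {v : V} (hv : v ∈ b.vars) :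
    v ∈ t.vars :=
  leaf_isSubtree_iff.1 ((leaf_isSubtree_iff.2 hv).trans h)

theorem IsSubtree.subst {b t : VTree ar V} (h : b.IsSubtree t) (σ : V → VTree ar W) :
    (b.subst σ).IsSubtree (t.subst σ) := by
  obtain ⟨u, hu⟩ := h
  exact ⟨u, sub_subst hu σ⟩

theorem isSubtree_subst {t : VTree ar V} {σ : V → VTree ar W} {b : VTree ar W}
    (h : b.IsSubtree (t.subst σ)) :
    (∃ a ts, (node a ts).IsSubtree t ∧ b = (node a ts).subst σ) ∨
      ∃ v ∈ t.vars, b.IsSubtree (σ v) := by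
  induction t with
  | leaf v => exact .inr ⟨v, by simp, h⟩
  | node a ts ih =>
    rcases isSubtree_node.1 h with rfl | ⟨i, hi⟩
    · exact .inl ⟨a, ts, .refl _, rfl⟩
    · rcases ih i hi with ⟨a', ts', h', rfl⟩ | ⟨v, hv, h'⟩
      · exact .inl ⟨a', ts', h'.trans (.child ts i), rfl⟩
      · exact .inr ⟨v, mem_vars_node.2 ⟨i, hv⟩, h'⟩

/-- Two variables below distinct children of a subtree sit at distinct leaves. -/
theorem IsSubtree.exists_leafAt_ne {t : VTree ar V} {a : S} {ts : Fin (ar a) → VTree ar V}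
    (h : (node a ts).IsSubtree t) {i j : Fin (ar a)} (hij : i ≠ j) {v w : V}
    (hv : v ∈ (ts i).vars) (hw : w ∈ (ts j).vars) :
    ∃ u u', u ≠ u' ∧ t.LeafAt u v ∧ t.LeafAt u' w := by
  obtain ⟨x, hx⟩ := h
  obtain ⟨y, hy⟩ := mem_vars_iff_leafAt.1 hv
  obtain ⟨z, hz⟩ := mem_vars_iff_leafAt.1 hw
  refine ⟨x ++ i.val :: y, x ++ j.val :: z, ?_, ?_, ?_⟩
  · intro he
    have := List.append_cancel_left he
    simp only [List.cons.injEq] at this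
    exact hij (Fin.ext this.1)
  · unfold LeafAt
    rw [sub_append_of_sub hx, sub_node_fin]
    exact hy
  · unfold LeafAt
    rw [sub_append_of_sub hx, sub_node_fin]
    exact hz

theorem nodup_map_vars_node_iff {ι : Type*} (f : V → ι) {a : S} {ts : Fin (ar a) → VTree ar V} :
    ((node a ts).vars.map f).Nodup ↔ (∀ i, ((ts i).vars.map f).Nodup) ∧
      ∀ i j, i ≠ j → ∀ v ∈ (ts i).vars, ∀ w ∈ (ts j).vars, f v ≠ f w := by
  have hsymm : Std.Symm (Function.onFun List.Disjoint fun i => (ts i).vars.map f) :=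
    ⟨fun _ _ h => h.symm⟩
  rw [vars_node, List.map_flatMap, List.nodup_flatMap]
  refine and_congr (by simp) ⟨fun h i j hij v hv w hw he => ?_, fun h => ?_⟩
  · refine h.forall (List.mem_finRange i) (List.mem_finRange j) hij
      (List.mem_map_of_mem hv) ?_
    rw [he]
    exact List.mem_map_of_mem hw
  · refine (List.nodup_finRange _).pairwise_of_forall_ne fun i _ j _ hij x hx hx' => ?_
    obtain ⟨v, hv, rfl⟩ := List.mem_map.1 hx
    obtain ⟨w, hw, he⟩ := List.mem_map.1 hx'
    exact h i j hij v hv w hw he.symm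

theorem leafAt_unique_of_nodup {ι : Type*} (f : V → ι) {t : VTree ar V}
    (h : (t.vars.map f).Nodup) {u u' : List ℕ} {v v' : V} (hu : t.LeafAt u v)
    (hu' : t.LeafAt u' v') (hf : f v = f v') : u = u' := by
  induction t generalizing u u' with
  | leaf w =>
    cases u <;> cases u' <;> simp_all [LeafAt]
  | node a ts ih =>
    cases u with
    | nil => simp [LeafAt] at hu
    | cons i u =>
    cases u' with
    | nil => simp [LeafAt] at hu'
    | cons i' u' =>
    obtain ⟨j, rfl, hj⟩ := sub_node_cons_eq_some hu
    obtain ⟨j', rfl, hj'⟩ := sub_node_cons_eq_some hu'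
    rw [nodup_map_vars_node_iff] at h
    by_cases hjj : j = j'
    · subst hjj
      rw [ih j (h.1 j) hj hj']
    · exact absurd hf (h.2 j j' hjj v (mem_vars_iff_leafAt.2 ⟨u, hj⟩) v'
        (mem_vars_iff_leafAt.2 ⟨u', hj'⟩))

/-- Substituting trees with pairwise disjoint variables into a linear tree gives a linear tree.
The fibres of `f` and `g` are the classes of labels that may occur only once. -/
theorem nodup_map_vars_subst {ι κ : Type*} (f : V → ι) (g : W → κ) {t : VTree ar V}
    {σ : V → VTree ar W} (ht : (t.vars.map f).Nodup) (hσ : ∀ v, ((σ v).vars.map g).Nodup)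
    (hd : ∀ v v', f v ≠ f v' → ∀ w ∈ (σ v).vars, ∀ w' ∈ (σ v').vars, g w ≠ g w') :
    ((t.subst σ).vars.map g).Nodup := by
  induction t with
  | leaf v => exact hσ v
  | node a ts ih =>
    rw [nodup_map_vars_node_iff] at ht
    rw [subst_node, nodup_map_vars_node_iff]
    refine ⟨fun i => ih i (ht.1 i), fun i j hij w hw w' hw' => ?_⟩
    obtain ⟨v, hv, hvw⟩ := mem_vars_subst.1 hw
    obtain ⟨v', hv', hvw'⟩ := mem_vars_subst.1 hw'
    exact hd v v' (ht.2 i j hij v hv v' hv') w hvw w' hvw'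

/-! ### Height -/

/-- The height of a tree; a leaf labeled by a variable has height `0`, and a nullary symbol
height `1`. -/
def height : VTree ar V → ℕ
  | leaf _ => 0
  | node _ ts => (Finset.univ.sup fun i => (ts i).height) + 1

@[simp] theorem height_leaf (v : V) : (leaf v : VTree ar V).height = 0 := rfl

theorem height_node_le_iff {a : S} {ts : Fin (ar a) → VTree ar V} {n : ℕ} :
    (node a ts).height ≤ n + 1 ↔ ∀ i, (ts i).height ≤ n := by
  simp [height, Finset.sup_le_iff]

theorem height_child_lt {a : S} (ts : Fin (ar a) → VTree ar V) (i : Fin (ar a)) :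
    (ts i).height < (node a ts).height :=
  Nat.lt_succ_of_le (Finset.le_sup (f := fun i => (ts i).height) (Finset.mem_univ i))

theorem IsSubtree.height_le {b t : VTree ar V} (h : b.IsSubtree t) : b.height ≤ t.height := by
  induction t with
  | leaf v => rw [isSubtree_leaf.1 h]
  | node a ts ih =>
    rcases isSubtree_node.1 h with rfl | ⟨i, hi⟩
    · exact le_rfl
    · exact (ih i hi).trans (height_child_lt ts i).le

theorem length_le_height {t b : VTree ar V} {u : List ℕ} (h : t.sub u = some b) :
    u.length ≤ t.height := by
  induction u generalizing t with
  | nil => simp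
  | cons i u ih =>
    cases t with
    | leaf v => simp at h
    | node a ts =>
      obtain ⟨j, rfl, hj⟩ := sub_node_cons_eq_some h
      exact (ih hj).trans_lt (height_child_lt ts j)

theorem height_subst_le {t : VTree ar V} {σ : V → VTree ar W} {n : ℕ}
    (h : ∀ v ∈ t.vars, (σ v).height ≤ n) : (t.subst σ).height ≤ t.height + n := by
  induction t with
  | leaf v => simpa using h v (by simp)
  | node a ts ih =>
    rw [subst_node, height, height, add_right_comm]
    refine Nat.succ_le_succ (Finset.sup_le fun i _ => ?_)
    refine (ih i fun v hv => h v (mem_vars_node.2 ⟨i, hv⟩)).trans ?_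
    gcongr
    exact Finset.le_sup (f := fun i => (ts i).height) (Finset.mem_univ i)

theorem finite_setOf_height_le [Finite S] [Finite V] (n : ℕ) :
    {t : VTree ar V | t.height ≤ n}.Finite := by
  induction n with
  | zero =>
    refine (Set.finite_range (leaf : V → VTree ar V)).subset ?_
    rintro (v | ⟨a, ts⟩) h
    · exact ⟨v, rfl⟩
    · simp [height] at h
  | succ n ih =>
    refine ((Set.finite_range (leaf : V → VTree ar V)).union (Set.finite_iUnion fun a : S =>
      (Set.Finite.pi' fun _ : Fin (ar a) => ih).image (node a))).subset ?_
    rintro (v | ⟨a, ts⟩) h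
    · exact .inl ⟨v, rfl⟩
    · exact .inr (Set.mem_iUnion.2 ⟨a, ts, height_node_le_iff.1 h, rfl⟩)

end VTree

/-! ### Transducers on trees with variables -/

namespace VTree

variable {S V : Type*} {ar : S → ℕ}

theorem isContext_iff {c : VTree ar (Fin 1)} : c.IsContext ↔ c.vars = [0] := by
  unfold IsContext IsPattern IsGround
  have : List.finRange 1 = [0] := rfl
  rw [this]
  constructor
  · rintro ⟨h | h, h'⟩
    · exact absurd h h'
    · exact h
  · intro h
    exact ⟨.inr h, by simp [h]⟩

theorem IsContext.vars_subst {c : VTree ar (Fin 1)} (hc : c.IsContext) (s : VTree ar V) :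
    (c.subst fun _ => s).vars = s.vars := by
  rw [VTree.vars_subst, isContext_iff.1 hc]
  simp

theorem IsContext.subst {c c' : VTree ar (Fin 1)} (hc : c.IsContext) (hc' : c'.IsContext) :
    (c.subst fun _ => c').IsContext := by
  rw [isContext_iff, hc.vars_subst, isContext_iff.1 hc']

theorem isContext_leaf : (leaf 0 : VTree ar (Fin 1)).IsContext := isContext_iff.2 rfl

theorem IsPattern.nodup {k : ℕ} {s : VTree ar (Fin k)} (hs : s.IsPattern) : s.vars.Nodup := by
  rcases hs with h | h
  · rw [h]
    exact List.nodup_nil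
  · rw [h]
    exact List.nodup_finRange k

end VTree

namespace Transducer

open VTree

variable {Q Q' S D V W : Type*} {arS : S → ℕ} {arD : D → ℕ} {T : Transducer Q arS arD}

@[simp] theorem stateEval_leaf (T : Transducer Q arS arD) (v : V) (q : Q) :
    T.stateEval (leaf v) q = leaf (q, v) := rfl

@[simp] theorem stateEval_node (T : Transducer Q arS arD) (a : S)
    (ts : Fin (arS a) → VTree arS V) (q : Q) : T.stateEval (node a ts) q =
      (T.rhs q a).subst (fun p => T.stateEval (ts p.2) p.1) := rfl

theorem stateEval_subst (T : Transducer Q arS arD) (s : VTree arS V) (σ : V → VTree arS W)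
    (q : Q) : T.stateEval (s.subst σ) q =
      (T.stateEval s q).subst (fun p => T.stateEval (σ p.2) p.1) := by
  induction s generalizing q with
  | leaf v => rfl
  | node a ts ih => simp [ih, subst_subst]

theorem eval_subst (T : Transducer Q arS arD) (s : VTree arS V) (σ : V → VTree arS W) :
    T.eval (s.subst σ) = (T.eval s).subst (fun p => T.stateEval (σ p.2) p.1) := by
  simp [eval, stateEval_subst, subst_subst]

theorem mem_vars_of_mem_stateEval {s : VTree arS V} {q : Q} {p : Q × V}
    (h : p ∈ (T.stateEval s q).vars) : p.2 ∈ s.vars := by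
  induction s generalizing q with
  | leaf v => simp_all
  | node a ts ih =>
    rw [stateEval_node] at h
    obtain ⟨x, -, hx⟩ := mem_vars_subst.1 h
    exact mem_vars_node.2 ⟨x.2, ih _ hx⟩

/-- The output of the state `q` on a ground tree, as a ground tree. -/
def stateOutput (T : Transducer Q arS arD) (s : GroundTree arS) (q : Q) : GroundTree arD :=
  (T.stateEval s q).subst (fun p => p.2.elim)

/-- The ground tree obtained from `t ∈ T_Δ[Q(V)]` by letting the states process the ground trees
that `σ` assigns to the variables. -/
def instantiate (T : Transducer Q arS arD) (σ : V → GroundTree arS) (t : VTree arD (Q × V)) :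
    GroundTree arD :=
  t.subst (fun p => T.stateOutput (σ p.2) p.1)

@[simp] theorem instantiate_leaf (σ : V → GroundTree arS) (p : Q × V) :
    T.instantiate σ (leaf p) = T.stateOutput (σ p.2) p.1 := rfl

@[simp] theorem instantiate_node (σ : V → GroundTree arS) (d : D)
    (ts : Fin (arD d) → VTree arD (Q × V)) :
    T.instantiate σ (node d ts) = node d (fun i => T.instantiate σ (ts i)) := rfl

theorem output_subst (T : Transducer Q arS arD) (s : VTree arS V) (σ : V → GroundTree arS) :
    T.output (s.subst σ) = T.instantiate σ (T.eval s) := by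
  simp only [output, eval_subst, subst_subst, instantiate, stateOutput]

theorem Equivalent.instantiate_eval {T' : Transducer Q' arS arD} (h : T.Equivalent T')
    (s : VTree arS V) (σ : V → GroundTree arS) :
    T'.instantiate σ (T'.eval s) = T.instantiate σ (T.eval s) := by
  rw [← output_subst, ← output_subst, h]

/-! ### Earliest transducers -/

/-- The root symbol of the output of a state of an earliest transducer is not constant. -/
theorem IsEarliest.exists_ne_node (hT : T.IsEarliest) (q : Q) (d : D) :
    ∃ s : GroundTree arS, ∀ ts, T.stateOutput s q ≠ node d ts := by
  by_contra! h
  obtain ⟨σ, hσ⟩ := (hT q).2.2 (arD d) (node d leaf) (.inr (by simp [vars_node])) (by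
    rintro _ ⟨s, rfl⟩
    obtain ⟨ts, hts⟩ := h s
    simp only [stateOutput] at hts
    cases hs : T.stateEval s q with
    | leaf p => exact p.2.elim
    | node d' ts' =>
      rw [hs] at hts
      simp only [subst_node, node.injEq] at hts
      obtain ⟨rfl, -⟩ := hts
      exact ⟨ts', by simp [hs]⟩)
  simp at hσ

theorem IsCanonicalEarliest.exists_stateOutput_ne (hT : T.IsCanonicalEarliest) {q q' : Q}
    (h : q ≠ q') : ∃ s : GroundTree arS, T.stateOutput s q ≠ T.stateOutput s q' := by
  obtain ⟨s, hs⟩ := hT.2 q q' h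
  refine ⟨s, fun he => hs ?_⟩
  have key : ∀ t : VTree arD (Q × Empty),
      (t.subst fun p => p.2.elim : GroundTree arD).subst (fun e => e.elim) = t := by
    intro t
    rw [subst_subst]
    conv_rhs => rw [← subst_id t]
    exact (subst_eq_subst_iff _ _ _).2 fun p _ => p.2.elim
  rw [← key (T.stateEval s q), ← key (T.stateEval s q')]
  exact congrArg _ he

theorem stateOutput_eq_of_instantiate_eq {t : VTree arD (Q × V)} {σ σ' : V → GroundTree arS}
    (h : T.instantiate σ t = T.instantiate σ' t) {p : Q × V} (hp : p ∈ t.vars) :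
    T.stateOutput (σ p.2) p.1 = T.stateOutput (σ' p.2) p.1 :=
  (subst_eq_subst_iff _ _ _).1 h p hp

/-- If the instances of a tree depend only on the tree substituted for `i`, then `i` is the only
variable of the tree. -/
theorem IsEarliest.eq_of_instantiate (hT : T.IsEarliest) {t : VTree arD (Q × V)} {i : V}
    {F : GroundTree arS → GroundTree arD} (g : GroundTree arS)
    (h : ∀ σ, T.instantiate σ t = F (σ i)) {p : Q × V} (hp : p ∈ t.vars) : p.2 = i := by
  classical
  by_contra hne
  have key : ∀ s, T.stateOutput s p.1 = T.stateOutput g p.1 := by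
    intro s
    have := stateOutput_eq_of_instantiate_eq (T := T) (t := t)
      (σ := Function.update (fun _ => g) p.2 s) (σ' := fun _ => g)
      (by rw [h, h, Function.update_of_ne (Ne.symm hne)]) hp
    simpa using this
  cases hg : T.stateOutput g p.1 with
  | leaf e => exact e.elim
  | node d ts =>
    obtain ⟨s, hs⟩ := hT.exists_ne_node p.1 d
    exact hs ts (by rw [key s, hg])

/-- In a canonical earliest transducer, a tree in `T_Δ[Q(V)]` with at most one variable is
determined by the function that it defines. -/
theorem IsCanonicalEarliest.eq_of_instantiate_eq [Subsingleton V] (hT : T.IsCanonicalEarliest)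
    (g : GroundTree arS) {t t' : VTree arD (Q × V)}
    (h : ∀ σ, T.instantiate σ t = T.instantiate σ t') : t = t' := by
  induction t generalizing t' with
  | leaf p =>
    cases t' with
    | leaf p' =>
      have h2 : p.2 = p'.2 := Subsingleton.elim _ _
      have h1 : p.1 = p'.1 := by
        by_contra hne
        obtain ⟨s, hs⟩ := hT.exists_stateOutput_ne hne
        exact hs (by simpa using h fun _ => s)
      rw [Prod.ext h1 h2]
    | node d ts =>
      obtain ⟨s, hs⟩ := hT.1.exists_ne_node p.1 d
      exact absurd (by simpa using h fun _ => s) (hs _)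
  | node d ts ih =>
    cases t' with
    | leaf p =>
      obtain ⟨s, hs⟩ := hT.1.exists_ne_node p.1 d
      exact absurd (by simpa using (h fun _ => s).symm) (hs _)
    | node d' ts' =>
      have h0 := h fun _ => g
      simp only [instantiate_node, node.injEq] at h0
      obtain ⟨rfl, -⟩ := h0
      congr 1
      funext i
      refine ih i fun σ => ?_
      have := h σ
      simp only [instantiate_node, node.injEq, heq_eq_eq, true_and] at this
      exact congrFun this i

/-- The output of an earliest transducer on a tree with variables extends that of any
equivalent transducer: every leaf `q(x_i)` lies at or below a node `u` which is a leaf `q'(x_i)`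
of the other tree, and the subtree at `u` defines the same function as `q'`. -/
theorem IsEarliest.exists_leafAt_prefix (hT : T.IsEarliest) {T' : Transducer Q' arS arD}
    {t : VTree arD (Q × V)} {t' : VTree arD (Q' × V)}
    (h : ∀ σ, T'.instantiate σ t' = T.instantiate σ t) (g : GroundTree arS) {w : List ℕ}
    {p : Q × V} (hp : t.LeafAt w p) :
    ∃ u q' b, t'.LeafAt u (q', p.2) ∧ t.sub u = some b ∧ u <+: w ∧
      (∀ x ∈ b.vars, x.2 = p.2) ∧ ∀ σ, T.instantiate σ b = T'.stateOutput (σ p.2) q' := by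
  induction t' generalizing t w with
  | leaf x =>
    have hv : ∀ y ∈ t.vars, y.2 = x.2 := fun y hy =>
      hT.eq_of_instantiate g (F := fun s => T'.stateOutput s x.1) (fun σ => (h σ).symm) hy
    have hpx := hv p (mem_vars_iff_leafAt.2 ⟨w, hp⟩)
    rw [hpx]
    exact ⟨[], x.1, t, by simp [LeafAt], by simp, List.nil_prefix, hv, fun σ => (h σ).symm⟩
  | node d ts' ih =>
    cases t with
    | leaf y =>
      obtain ⟨s, hs⟩ := hT.exists_ne_node y.1 d
      exact absurd (by simpa using (h fun _ => s).symm) (hs _)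
    | node d' ts =>
      have h0 := h fun _ => g
      simp only [instantiate_node, node.injEq] at h0
      obtain ⟨rfl, -⟩ := h0
      cases w with
      | nil => simp [LeafAt] at hp
      | cons i w =>
      obtain ⟨j, rfl, hj⟩ := sub_node_cons_eq_some hp
      obtain ⟨u, q', b, h1, h2, h3, h4⟩ := ih j (t := ts j) (fun σ => by
        have := h σ
        simp only [instantiate_node, node.injEq, heq_eq_eq, true_and] at this
        exact congrFun this j) hj
      exact ⟨j.val :: u, q', b, by simpa [LeafAt] using h1, by simpa using h2,
        List.cons_prefix_cons.2 ⟨rfl, h3⟩, h4⟩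

theorem IsLinear.nodup_stateEval (hT : T.IsLinear) {s : VTree arS V} (hs : s.vars.Nodup) (q : Q) :
    ((T.stateEval s q).vars.map Prod.snd).Nodup := by
  induction s generalizing q with
  | leaf v => simp
  | node a ts ih =>
    have hs' := (nodup_map_vars_node_iff id).1 (by simpa using hs)
    refine nodup_map_vars_subst Prod.snd Prod.snd (hT.2 q a)
      (fun p => ih p.2 (by simpa using hs'.1 p.2) p.1) fun p p' hne x hx x' hx' => ?_
    exact hs'.2 _ _ hne _ (mem_vars_of_mem_stateEval hx) _ (mem_vars_of_mem_stateEval hx')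

theorem IsLinear.nodup_eval (hT : T.IsLinear) {s : VTree arS V} (hs : s.vars.Nodup) :
    ((T.eval s).vars.map Prod.snd).Nodup :=
  nodup_map_vars_subst Prod.snd Prod.snd hT.1 (fun p => hT.nodup_stateEval hs p.1)
    fun _ _ hne => absurd (Subsingleton.elim _ _) hne

/-! ### Necessity -/

theorem IsEarliest.nonempty_groundTree (hT : T.IsEarliest) (q : Q) (d : D) :
    Nonempty (GroundTree arS) :=
  ⟨(hT.exists_ne_node q d).choose⟩

/-- All leaves of `T(s)` that process `x_i` lie below the unique leaf of `T'(s)` that does, and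
nothing else lies there. -/
theorem IsEarliest.lcaConform_of_equivalent (hT : T.IsEarliest) {T' : Transducer Q' arS arD}
    (hlin : T'.IsLinear) (he : T.Equivalent T') : T.LcaConform := by
  rintro k s hs i v ⟨⟨w, q, hw⟩, hv, hmax⟩ b hb ⟨y, r, j, hji, hy⟩
  by_cases hg : Nonempty (GroundTree arS)
  · obtain ⟨g⟩ := hg
    obtain ⟨u, q', b', h1, h2, h3, h4, -⟩ :=
      hT.exists_leafAt_prefix (fun σ => he.instantiate_eval s σ) g hw
    -- by linearity, all leaves labeled by `x_i` lie below the same node `u`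
    have huv : u <+: v := by
      refine hmax u fun w' hw' => ?_
      obtain ⟨q₂, hq₂⟩ := hw'
      obtain ⟨u', q'', -, h1', -, h3', -⟩ :=
        hT.exists_leafAt_prefix (fun σ => he.instantiate_eval s σ) g hq₂
      rwa [leafAt_unique_of_nodup Prod.snd (hlin.nodup_eval hs.nodup) h1 h1' rfl]
    obtain ⟨z, rfl⟩ := huv
    rw [sub_append_of_sub h2] at hb
    exact hji (h4 (r, j) (IsSubtree.vars_subset ⟨z, hb⟩ (mem_vars_iff_leafAt.2 ⟨y, hy⟩)))
  · -- without ground input trees there are no output symbols, so `T(s)` is a leaf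
    cases hts : T.eval s with
    | node d ts => exact hg (hT.nonempty_groundTree q d)
    | leaf p =>
      rw [hts] at hw hb
      obtain rfl := isSubtree_leaf.1 ⟨v, hb⟩
      have e1 := isSubtree_leaf.1 ⟨w, hw⟩
      have e2 := isSubtree_leaf.1 ⟨y, hy⟩
      rw [← e1] at e2
      simp only [leaf.injEq, Prod.mk.injEq] at e2
      exact hji e2.2

/-- The context `c` nested `n` times. -/
def contextPow (c : VTree arS (Fin 1)) : ℕ → VTree arS (Fin 1)
  | 0 => leaf 0
  | n + 1 => c.subst fun _ => contextPow c n

theorem isContext_contextPow {c : VTree arS (Fin 1)} (hc : c.IsContext) (n : ℕ) :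
    (contextPow c n).IsContext := by
  induction n with
  | zero => exact isContext_leaf
  | succ n ih => exact hc.subst ih

/-- A leaf that reproduces its state is pumped along the powers of a context. -/
theorem exists_leafAt_contextPow {c : VTree arS (Fin 1)} {q : Q} {w : List ℕ}
    (h : (T.stateEval c q).LeafAt w (q, 0)) (n : ℕ) :
    ∃ z, z.length = n * w.length ∧ (T.stateEval (contextPow c n) q).LeafAt z (q, 0) := by
  induction n with
  | zero => exact ⟨[], by simp, by simp [contextPow, LeafAt]⟩
  | succ n ih =>
    obtain ⟨z, hz, hz'⟩ := ih
    refine ⟨w ++ z, by simp [hz]; ring, ?_⟩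
    rw [contextPow, stateEval_subst]
    exact h.subst hz'

/-- If two pairwise occurring states had an output generating loop, then pumping the loop would
push one of them arbitrarily far below the unique leaf of the output of `T'`. -/
theorem IsCanonicalEarliest.zeroOutputTwinned_of_equivalent [Finite Q']
    (hT : T.IsCanonicalEarliest) {T' : Transducer Q' arS arD} (hlin : T'.IsLinear)
    (he : T.Equivalent T') : T.ZeroOutputTwinned := by
  rintro q₁ q₂ ⟨c₀, hc₀, v₁, v₂, hne, hv₁, hv₂⟩
    ⟨c, hc, -, ⟨w₁, hw₁⟩, ⟨w₂, hw₂⟩, hout⟩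
  obtain ⟨d, ts, hd⟩ : ∃ d ts, T.eval c₀ = node d ts := by
    cases h : T.eval c₀ with
    | node d ts => exact ⟨d, ts, rfl⟩
    | leaf p =>
      exfalso
      rw [h] at hv₁ hv₂
      cases v₁ <;> cases v₂ <;> simp_all [LeafAt]
  obtain ⟨g⟩ := hT.1.nonempty_groundTree q₁ d
  -- the tree that defines the same function as a state of `T'` is unique, hence of bounded height
  obtain ⟨H, hH⟩ : ∃ H, ∀ (q' : Q') (b : VTree arD (Q × Fin 1)),
      (∀ σ, T.instantiate σ b = T'.stateOutput (σ 0) q') → b.height ≤ H := by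
    have : ∀ q' : Q', ∃ H, ∀ b : VTree arD (Q × Fin 1),
        (∀ σ, T.instantiate σ b = T'.stateOutput (σ 0) q') → b.height ≤ H := by
      intro q'
      by_cases hb : ∃ b : VTree arD (Q × Fin 1),
          ∀ σ, T.instantiate σ b = T'.stateOutput (σ 0) q'
      · obtain ⟨b, hb⟩ := hb
        refine ⟨b.height, fun b' hb' => ?_⟩
        rw [hT.eq_of_instantiate_eq g fun σ => (hb' σ).trans (hb σ).symm]
      · exact ⟨0, fun b hb' => absurd ⟨b, hb'⟩ hb⟩
    choose f hf using this
    obtain ⟨H, hH⟩ := (Set.finite_range f).bddAbove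
    exact ⟨H, fun q' b hb => (hf q' b hb).trans (hH ⟨q', rfl⟩)⟩
  obtain ⟨z₁, hl₁, hz₁⟩ := exists_leafAt_contextPow hw₁ (H + 1)
  obtain ⟨z₂, hl₂, hz₂⟩ := exists_leafAt_contextPow hw₂ (H + 1)
  set s := c₀.subst fun _ => contextPow c (H + 1) with hs
  have hsc : s.IsContext := hc₀.subst (isContext_contextPow hc _)
  have k₁ : (T.eval s).LeafAt (v₁ ++ z₁) (q₁, 0) := by
    rw [hs, eval_subst]
    exact hv₁.subst hz₁
  have k₂ : (T.eval s).LeafAt (v₂ ++ z₂) (q₂, 0) := by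
    rw [hs, eval_subst]
    exact hv₂.subst hz₂
  obtain ⟨u, q', b, a1, a2, a3, -, a4⟩ :=
    hT.1.exists_leafAt_prefix (fun σ => he.instantiate_eval s σ) g k₁
  obtain ⟨u', q'', -, b1, -, b3, -⟩ :=
    hT.1.exists_leafAt_prefix (fun σ => he.instantiate_eval s σ) g k₂
  obtain rfl := leafAt_unique_of_nodup Prod.snd (hlin.nodup_eval hsc.1.nodup) a1 b1 rfl
  have hbH := hH q' b a4
  -- `u` is a common ancestor, so it lies above both `v₁` and `v₂`
  have hu₁ : u <+: v₁ := by
    rcases List.prefix_or_prefix_of_prefix a3 (List.prefix_append v₁ z₁) with h | ⟨x, rfl⟩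
    · exact h
    · obtain ⟨y, hy⟩ := b3
      exact absurd (by simpa using hy) (hv₁.append_ne_append hv₂ hne (x ++ y) z₂)
  have hu₂ : u <+: v₂ := by
    rcases List.prefix_or_prefix_of_prefix b3 (List.prefix_append v₂ z₂) with h | ⟨x, rfl⟩
    · exact h
    · obtain ⟨y, hy⟩ := a3
      exact absurd (by simpa using hy) (hv₂.append_ne_append hv₁ hne.symm (x ++ y) z₁)
  obtain ⟨x₁, rfl⟩ := hu₁
  obtain ⟨x₂, rfl⟩ := hu₂
  have l₁ : (x₁ ++ z₁).length ≤ b.height := by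
    refine length_le_height (b := leaf (q₁, 0)) ?_
    rw [← sub_append_of_sub a2, ← List.append_assoc]
    exact k₁
  have l₂ : (x₂ ++ z₂).length ≤ b.height := by
    refine length_le_height (b := leaf (q₂, 0)) ?_
    rw [← sub_append_of_sub a2, ← List.append_assoc]
    exact k₂
  rw [List.length_append, hl₁] at l₁
  rw [List.length_append, hl₂] at l₂
  have hpos : w₁ ≠ [] ∨ w₂ ≠ [] := by
    by_contra! h
    obtain ⟨rfl, rfl⟩ := h
    simp only [LeafAt, sub_nil, Option.some.injEq] at hw₁ hw₂
    exact hout.elim (fun h => h hw₁) (fun h => h hw₂)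
  rcases hpos with h | h
  · have := List.length_pos_iff.2 h
    nlinarith
  · have := List.length_pos_iff.2 h
    nlinarith

end Transducer

/-! ### Spines -/

namespace VTree

variable {S Q V W ι : Type*} {ar : S → ℕ}

/-- The node `a` whose `i`-th child is `c`; the other children are the leaf `false`, which stands
for an input subtree off the path. -/
def spineNode (a : S) (i : Fin (ar a)) (c : VTree ar Bool) : VTree ar Bool :=
  node a fun j => if j = i then c else leaf false

/-- A spine is a path in an input tree: the leaf at its end is labeled `true`, and all subtrees
off the path are replaced by the leaf `false`. -/
inductive IsSpine : VTree ar Bool → Prop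
  | hole : IsSpine (leaf true)
  | node (a : S) (i : Fin (ar a)) {c : VTree ar Bool} : IsSpine c → IsSpine (spineNode a i c)

/-- The substitution that puts `r` at the end of a spine and the ground tree `g` at every place
off the path. -/
def fill (g : GroundTree ar) (r : VTree ar V) (b : Bool) : VTree ar V :=
  if b then r else g.subst (fun e => e.elim)

theorem vars_groundTree_subst (g : GroundTree ar) (σ : Empty → VTree ar V) :
    (g.subst σ).vars = [] := by
  rw [vars_subst, List.flatMap_eq_nil_iff]
  exact fun e => e.elim

theorem flatMap_ite_eq_of_nodup {α β : Type*} [DecidableEq α] (i : α) (l : List β) :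
    ∀ L : List α, L.Nodup → L.flatMap (fun j => if j = i then l else []) =
      if i ∈ L then l else []
  | [], _ => by simp
  | j :: L, h => by
    have := flatMap_ite_eq_of_nodup i l L h.of_cons
    rw [List.flatMap_cons, this]
    by_cases hij : j = i
    · subst hij
      simp [(List.nodup_cons.1 h).1]
    · simp [hij, Ne.symm hij]

theorem vars_node_ite (a : S) (i : Fin (ar a)) (r : VTree ar V)
    (ts : Fin (ar a) → VTree ar V) (hi : ts i = r) (h : ∀ j ≠ i, (ts j).vars = []) :
    (node a ts).vars = r.vars := by
  have : (fun j => (ts j).vars) = fun j => if j = i then r.vars else [] := by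
    funext j
    split
    · rename_i hj
      rw [hj, hi]
    · rename_i hj
      exact h j hj
  rw [vars_node, this, flatMap_ite_eq_of_nodup i _ _ (List.nodup_finRange _)]
  simp

theorem IsSpine.vars_subst_fill {c : VTree ar Bool} (hc : IsSpine c) (g : GroundTree ar)
    (r : VTree ar V) : (c.subst (fill g r)).vars = r.vars := by
  induction hc with
  | hole => rfl
  | node a i _ ih =>
    rw [spineNode, subst_node, vars_node_ite a i _ _ rfl, ← ih]
    · simp
    · intro j hj
      simp [hj, fill, vars_groundTree_subst]

/-- The spine `c` is extended by the spine `c'` at its end. -/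
theorem IsSpine.extend {c c' : VTree ar Bool} (hc : IsSpine c) (hc' : IsSpine c') :
    IsSpine (c.subst fun b => if b then c' else leaf false) := by
  induction hc with
  | hole => simpa using hc'
  | node a i _ ih =>
    convert IsSpine.node a i ih using 1
    simp only [spineNode, subst_node]
    congr 1
    funext j
    split <;> simp

/-- The context that consists of the symbol `a`, with its variable at child `i` and the ground
tree `g` at all other children. -/
def stepContext (g : GroundTree ar) (a : S) (i : Fin (ar a)) : VTree ar (Fin 1) :=
  node a fun j => if j = i then leaf 0 else g.subst (fun e => e.elim)

theorem isContext_stepContext (g : GroundTree ar) (a : S) (i : Fin (ar a)) :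
    (stepContext g a i).IsContext := by
  rw [isContext_iff, stepContext, vars_node_ite a i (leaf 0)]
  · rfl
  · simp
  · intro j hj
    simp [hj, vars_groundTree_subst]

/-! ### Trees that branch at the root, and separation of variables -/

/-- The tree over `Q(V)` obtained from a tree over `Q` by labeling all leaves with the same
variable `i`. -/
def tag (i : ι) (t : VTree ar Q) : VTree ar (Q × ι) := t.subst fun q => leaf (q, i)

@[simp] theorem tag_leaf (i : ι) (q : Q) : (leaf q : VTree ar Q).tag i = leaf (q, i) := rfl

@[simp] theorem tag_node (i : ι) (a : S) (ts : Fin (ar a) → VTree ar Q) :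
    (node a ts).tag i = node a fun j => (ts j).tag i := rfl

theorem subst_tag (i : ι) (t : VTree ar Q) (σ : Q × ι → VTree ar W) :
    (t.tag i).subst σ = t.subst fun q => σ (q, i) := by
  simp [tag, subst_subst]

theorem mem_vars_tag {i : ι} {t : VTree ar Q} {q : Q} :
    (q, i) ∈ (t.tag i).vars ↔ q ∈ t.vars := by
  simp [tag, mem_vars_subst]

@[simp] theorem height_tag (i : ι) (t : VTree ar Q) : (t.tag i).height = t.height := by
  induction t with
  | leaf q => rfl
  | node a ts ih => simp [height, ih]

/-- The root is the lowest common ancestor of the leaves labeled by variables: the tree is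
such a leaf, or at least two children of its root contain variables. -/
def BranchesAtRoot : VTree ar V → Prop
  | leaf _ => True
  | node a ts => ∃ j j' : Fin (ar a), j ≠ j' ∧ (∃ v, v ∈ (ts j).vars) ∧ ∃ v, v ∈ (ts j').vars

/-- Whenever two children of some node contain the same variable `i`, no other variable occurs
below that node. -/
def Separated : VTree ar (Q × ι) → Prop
  | leaf _ => True
  | node a ts => (∀ j, (ts j).Separated) ∧ ∀ (i : ι) (j j' : Fin (ar a)), j ≠ j' →
      (∃ x ∈ (ts j).vars, x.2 = i) → (∃ x ∈ (ts j').vars, x.2 = i) →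
        ∀ x ∈ (node a ts).vars, x.2 = i

theorem Separated.of_isSubtree {t b : VTree ar (Q × ι)} (ht : t.Separated) (h : b.IsSubtree t) :
    b.Separated := by
  induction t with
  | leaf x => rw [isSubtree_leaf.1 h]; trivial
  | node a ts ih =>
    rcases isSubtree_node.1 h with rfl | ⟨j, hj⟩
    · exact ht
    · exact ih j (ht.1 j) hj

/-- Separation follows from the condition on lowest common ancestors: a node with two children
that contain `i` lies at or below the lowest common ancestor of all leaves labeled by `i`. -/
theorem separated_of_lowestCommonAncestor {t : VTree ar (Q × ι)}
    (h : ∀ i v, IsLowestCommonAncestor {u | ∃ q, t.LeafAt u (q, i)} v →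
      ∀ b, t.sub v = some b → ∀ x ∈ b.vars, x.2 = i) : t.Separated := by
  induction t with
  | leaf x => trivial
  | node a ts ih =>
    have leafAt_of_mem : ∀ i (j : Fin (ar a)), (∃ x ∈ (ts j).vars, x.2 = i) →
        ∃ u q, (node a ts).LeafAt (j.val :: u) (q, i) := by
      rintro i j ⟨⟨q, _⟩, hx, rfl⟩
      obtain ⟨u, hu⟩ := mem_vars_iff_leafAt.1 hx
      exact ⟨u, q, by simpa [LeafAt] using hu⟩
    have hroot : ∀ (i : ι) (j j' : Fin (ar a)), j ≠ j' → (∃ x ∈ (ts j).vars, x.2 = i) →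
        (∃ x ∈ (ts j').vars, x.2 = i) → ∀ x ∈ (node a ts).vars, x.2 = i := by
      intro i j j' hne hj hj'
      obtain ⟨u, q, hu⟩ := leafAt_of_mem i j hj
      obtain ⟨u', q', hu'⟩ := leafAt_of_mem i j' hj'
      refine h i [] ⟨⟨_, q, hu⟩, fun _ _ => List.nil_prefix, fun w hw => ?_⟩ _ (sub_nil _)
      cases w with
      | nil => exact List.nil_prefix
      | cons m w =>
        have e1 := (List.cons_prefix_cons.1 (hw _ ⟨q, hu⟩)).1
        have e2 := (List.cons_prefix_cons.1 (hw _ ⟨q', hu'⟩)).1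
        exact absurd (Fin.ext (e1.symm.trans e2)) hne
    refine ⟨fun j => ih j fun i v hv b hb => ?_, hroot⟩
    obtain ⟨⟨u₀, q₀, hu₀⟩, hpre, hmax⟩ := hv
    by_cases hocc : ∃ j' ≠ j, ∃ x ∈ (ts j').vars, x.2 = i
    · obtain ⟨j', hne, hj'⟩ := hocc
      intro x hx
      exact hroot i j j' hne.symm ⟨_, mem_vars_iff_leafAt.2 ⟨u₀, hu₀⟩, rfl⟩ hj' x
        (mem_vars_node.2 ⟨j, IsSubtree.vars_subset ⟨v, hb⟩ hx⟩)
    · push Not at hocc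
      refine h i (j.val :: v) ⟨⟨j.val :: u₀, q₀, ?_⟩, ?_, ?_⟩ b (by simpa using hb)
      · simpa [LeafAt] using hu₀
      · rintro (_ | ⟨m, u⟩) ⟨q, hq⟩
        · simp [LeafAt] at hq
        · obtain ⟨j', rfl, hj'⟩ := sub_node_cons_eq_some hq
          by_cases hjj : j' = j
          · subst hjj
            exact List.cons_prefix_cons.2 ⟨rfl, hpre u ⟨q, hj'⟩⟩
          · exact absurd rfl (hocc j' hjj (q, i) (mem_vars_iff_leafAt.2 ⟨u, hj'⟩))
      · intro w hw
        cases w with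
        | nil => exact List.nil_prefix
        | cons m w =>
          have e := hw (j.val :: u₀) ⟨q₀, by simpa [LeafAt] using hu₀⟩
          refine List.cons_prefix_cons.2 ⟨(List.cons_prefix_cons.1 e).1, hmax w fun u hu => ?_⟩
          obtain ⟨q, hq⟩ := hu
          exact (List.cons_prefix_cons.1
            (hw (j.val :: u) ⟨q, by simpa [LeafAt] using hq⟩)).2

/-- A separated tree factors through a linear tree: the maximal subtrees that have only one
variable and branch at the root are represented by single leaves. -/
theorem Separated.exists_linear {Q' : Type*} {val : Q' → VTree ar Q} {t : VTree ar (Q × ι)}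
    (ht : t.Separated)
    (hval : ∀ b i, b.BranchesAtRoot → (b.tag i).IsSubtree t → ∃ q', val q' = b) :
    ∃ t' : VTree ar (Q' × ι), t'.subst (fun p => (val p.1).tag p.2) = t ∧
      (t'.vars.map Prod.snd).Nodup ∧ ∀ x ∈ t'.vars, ∃ y ∈ t.vars, y.2 = x.2 := by
  induction t with
  | leaf x =>
    obtain ⟨q', hq'⟩ := hval (leaf x.1) x.2 trivial (.refl _)
    exact ⟨leaf (q', x.2), by simp [hq'], by simp, by simp⟩
  | node a ts ih =>
    by_cases hroot : ∃ (i : ι) (j j' : Fin (ar a)), j ≠ j' ∧ (∃ x ∈ (ts j).vars, x.2 = i) ∧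
        ∃ x ∈ (ts j').vars, x.2 = i
    · -- the whole tree has the single variable `i` and branches at its root
      obtain ⟨i, j, j', hne, hj, hj'⟩ := hroot
      have hall := ht.2 i j j' hne hj hj'
      set b : VTree ar Q := (node a ts).subst fun x => leaf x.1 with hb
      have htag : b.tag i = node a ts := by
        rw [hb, tag, subst_subst]
        conv_rhs => rw [← subst_id (node a ts)]
        exact (subst_eq_subst_iff _ _ _).2 fun x hx => by simp [← hall x hx]
      obtain ⟨x, hx, hxi⟩ := hj
      obtain ⟨x', hx', -⟩ := hj'
      obtain ⟨q', hq'⟩ := hval b i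
        ⟨j, j', hne, ⟨x.1, mem_vars_subst.2 ⟨x, hx, by simp⟩⟩,
          ⟨x'.1, mem_vars_subst.2 ⟨x', hx', by simp⟩⟩⟩ (by rw [htag]; exact .refl _)
      refine ⟨leaf (q', i), by simp [hq', htag], by simp, fun y hy => ?_⟩
      rw [vars_leaf, List.mem_singleton] at hy
      exact ⟨x, mem_vars_node.2 ⟨j, hx⟩, by rw [hy, hxi]⟩
    · -- no variable occurs below two children, so the factorizations of the children combine
      have := fun j => ih j (ht.1 j) fun b i hb hbt => hval b i hb (hbt.trans (.child ts j))
      choose ts' h1 h2 h3 using this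
      refine ⟨node a ts', by simp [h1], (nodup_map_vars_node_iff _).2 ⟨h2, ?_⟩, fun x hx => ?_⟩
      · intro j j' hne v hv w hw he
        refine hroot ⟨v.2, j, j', hne, h3 j v hv, ?_⟩
        rw [he]
        exact h3 j' w hw
      · obtain ⟨j, hj⟩ := mem_vars_node.1 hx
        obtain ⟨y, hy, hyx⟩ := h3 j x hj
        exact ⟨y, mem_vars_node.2 ⟨j, hy⟩, hyx⟩

end VTree

namespace Transducer

open VTree

variable {Q Q' S D V : Type*} {arS : S → ℕ} {arD : D → ℕ} {T : Transducer Q arS arD}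

theorem LcaConform.separated_eval (hT : T.LcaConform) {k : ℕ} {s : VTree arS (Fin k)}
    (hs : s.IsPattern) : (T.eval s).Separated := by
  refine separated_of_lowestCommonAncestor fun i v hv b hb x hx => ?_
  by_contra hne
  obtain ⟨w, hw⟩ := mem_vars_iff_leafAt.1 hx
  exact hT k s hs i v hv b hb ⟨w, x.1, x.2, hne, hw⟩

/-! ### Bounded delay of pairwise occurring states -/

/-- Some context leads from the pair `v` of states to the pair `v'`. -/
def Leads (T : Transducer Q arS arD) (v v' : Q × Q) : Prop :=
  ∃ c : VTree arS (Fin 1), c.IsContext ∧ (v'.1, 0) ∈ (T.stateEval c v.1).vars ∧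
    (v'.2, 0) ∈ (T.stateEval c v.2).vars

/-- Some context leads from the pair `v` of states to the pair `v'`, and at least one of the two
states generates output on it. -/
def LeadsWithOutput (T : Transducer Q arS arD) (v v' : Q × Q) : Prop :=
  ∃ c : VTree arS (Fin 1), c.IsContext ∧ T.OutputStep c v.1 v.2 v'.1 v'.2

/-- The number of pairs of states that can be reached from `v` with output. -/
noncomputable def outputRank (T : Transducer Q arS arD) (v : Q × Q) : ℕ :=
  {v' | T.LeadsWithOutput v v'}.ncard

theorem LeadsWithOutput.leads {v v' : Q × Q} (h : T.LeadsWithOutput v v') : T.Leads v v' := by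
  obtain ⟨c, hc, h1, h2, -⟩ := h
  exact ⟨c, hc, mem_vars_iff_leafAt.2 h1, mem_vars_iff_leafAt.2 h2⟩

theorem stateEval_subst_ne_leaf {c c' : VTree arS (Fin 1)} {q q' q'' : Q}
    (h : (q', 0) ∈ (T.stateEval c q).vars) (h' : T.stateEval c' q' ≠ leaf (q'', 0)) :
    T.stateEval (c.subst fun _ => c') q ≠ leaf (q'', 0) := by
  rw [stateEval_subst]
  cases hq : T.stateEval c q with
  | leaf p =>
    rw [hq, vars_leaf, List.mem_singleton] at h
    subst h
    simpa using h'
  | node d ts => simp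

theorem Leads.trans_leadsWithOutput {v v' v'' : Q × Q} (h : T.Leads v v')
    (h' : T.LeadsWithOutput v' v'') : T.LeadsWithOutput v v'' := by
  obtain ⟨c, hc, h1, h2⟩ := h
  obtain ⟨c', hc', h3, h4, h5⟩ := h'
  refine ⟨c.subst fun _ => c', hc.subst hc', ?_, ?_,
    h5.imp (stateEval_subst_ne_leaf h1) (stateEval_subst_ne_leaf h2)⟩
  · rw [← mem_vars_iff_leafAt, stateEval_subst]
    exact mem_vars_subst.2 ⟨_, h1, mem_vars_iff_leafAt.2 h3⟩
  · rw [← mem_vars_iff_leafAt, stateEval_subst]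
    exact mem_vars_subst.2 ⟨_, h2, mem_vars_iff_leafAt.2 h4⟩

theorem Leads.occurPairwise {v v' : Q × Q} (h : T.Leads v v') (hv : T.OccurPairwise v.1 v.2) :
    T.OccurPairwise v'.1 v'.2 := by
  obtain ⟨c, hc, h1, h2⟩ := h
  obtain ⟨c₀, hc₀, u₁, u₂, hne, hu₁, hu₂⟩ := hv
  obtain ⟨w₁, hw₁⟩ := mem_vars_iff_leafAt.1 h1
  obtain ⟨w₂, hw₂⟩ := mem_vars_iff_leafAt.1 h2
  refine ⟨c₀.subst fun _ => c, hc₀.subst hc, u₁ ++ w₁, u₂ ++ w₂,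
    hu₁.append_ne_append hu₂ hne _ _, ?_, ?_⟩
  · rw [eval_subst]
    exact hu₁.subst hw₁
  · rw [eval_subst]
    exact hu₂.subst hw₂

theorem Leads.outputRank_le [Finite Q] {v v' : Q × Q} (h : T.Leads v v') :
    T.outputRank v' ≤ T.outputRank v :=
  Set.ncard_le_ncard (fun _ hv => h.trans_leadsWithOutput hv) (Set.toFinite _)

theorem ZeroOutputTwinned.not_leadsWithOutput (hT : T.ZeroOutputTwinned) {v : Q × Q}
    (hv : T.OccurPairwise v.1 v.2) : ¬ T.LeadsWithOutput v v := by
  rintro ⟨c, hc, hout⟩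
  refine hT v.1 v.2 hv ⟨c, hc, ?_, hout⟩
  rintro rfl
  obtain ⟨-, -, h | h⟩ := hout <;> exact h rfl

/-- The pair `v'` itself can be reached with output from `v`, but not from `v'`. -/
theorem ZeroOutputTwinned.outputRank_lt [Finite Q] (hT : T.ZeroOutputTwinned) {v v' : Q × Q}
    (hv : T.OccurPairwise v.1 v.2) (h : T.LeadsWithOutput v v') :
    T.outputRank v' < T.outputRank v := by
  refine Set.ncard_lt_ncard ⟨fun _ hv' => h.leads.trans_leadsWithOutput hv', fun hsub => ?_⟩
    (Set.toFinite _)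
  exact hT.not_leadsWithOutput (h.leads.occurPairwise hv) (hsub h)

theorem leafAt_stateEval_stepContext (g : GroundTree arS) {a : S} {i : Fin (arS a)} {q q' : Q}
    {u : List ℕ} (h : (T.rhs q a).LeafAt u (q', i)) :
    (T.stateEval (stepContext g a i) q).LeafAt u (q', 0) := by
  rw [stepContext, stateEval_node, ← List.append_nil u]
  exact h.subst (by simp [LeafAt])

theorem mem_vars_stateEval_stepContext (g : GroundTree arS) {a : S} {i : Fin (arS a)} {q q' : Q}
    (h : (q', i) ∈ (T.rhs q a).vars) :
    (q', 0) ∈ (T.stateEval (stepContext g a i) q).vars := by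
  obtain ⟨u, hu⟩ := mem_vars_iff_leafAt.1 h
  exact mem_vars_iff_leafAt.2 ⟨u, leafAt_stateEval_stepContext g hu⟩

theorem stateEval_spineNode (T : Transducer Q arS arD) (a : S) (i : Fin (arS a))
    (c : VTree arS Bool) (q : Q) : T.stateEval (spineNode a i c) q =
      (T.rhs q a).subst fun p => if p.2 = i then T.stateEval c p.1 else leaf (p.1, false) := by
  rw [spineNode, stateEval_node]
  congr 1
  funext p
  split <;> simp

/-- The output of `p` along a spine on which a pairwise occurring state `r` survives is bounded:
each output of `p` decreases the rank of the current pair of states. -/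
theorem ZeroOutputTwinned.height_stateEval_le [Finite Q] (hT : T.ZeroOutputTwinned)
    (g : GroundTree arS) {M : ℕ} (hM : ∀ q a, (T.rhs q a).height ≤ M) {c : VTree arS Bool}
    (hc : IsSpine c) {p r : Q} (hpr : T.OccurPairwise p r)
    (hr : ∃ r', (r', true) ∈ (T.stateEval c r).vars) :
    (T.stateEval c p).height ≤ M * (T.outputRank (p, r) + 1) := by
  induction hc generalizing p r with
  | hole => simp
  | node a i _ ih =>
    rename_i c
    obtain ⟨r'', hr''⟩ := hr
    rw [stateEval_spineNode] at hr''
    obtain ⟨⟨r', j⟩, hj, hr'⟩ := mem_vars_subst.1 hr''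
    obtain rfl : j = i := by
      by_contra hne
      simp [hne] at hr'
    simp only [if_true] at hr'
    have hrc := mem_vars_stateEval_stepContext g hj
    have hlead : ∀ p', (p', j) ∈ (T.rhs p a).vars → T.Leads (p, r) (p', r') := fun p' hp' =>
      ⟨_, isContext_stepContext g a j, mem_vars_stateEval_stepContext g hp', hrc⟩
    rw [stateEval_spineNode]
    cases hp : T.rhs p a with
    | leaf x =>
      obtain ⟨p', i'⟩ := x
      by_cases hi : i' = j
      · subst hi
        have hl := hlead p' (by simp [hp])
        simp only [subst_leaf, if_true]
        exact (ih (hl.occurPairwise hpr) ⟨r'', hr'⟩).trans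
          (Nat.mul_le_mul_left _ (Nat.succ_le_succ hl.outputRank_le))
      · simp [hi]
    | node d ts =>
      -- the rule generates output, so the rank of every successor pair is smaller
      rw [← hp, mul_add, mul_one, add_comm]
      refine (height_subst_le (n := M * T.outputRank (p, r)) fun x hx => ?_).trans
        (Nat.add_le_add_right (hM p a) _)
      obtain ⟨p', i'⟩ := x
      by_cases hi : i' = j
      · subst hi
        have hl := hlead p' hx
        have hout : T.LeadsWithOutput (p, r) (p', r') :=
          ⟨_, isContext_stepContext g a i', mem_vars_iff_leafAt.1
            (mem_vars_stateEval_stepContext g hx), mem_vars_iff_leafAt.1 hrc, .inl (by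
              simp [stepContext, hp])⟩
        simp only [if_true]
        exact (ih (hl.occurPairwise hpr) ⟨r'', hr'⟩).trans
          (Nat.mul_le_mul_left _ (hT.outputRank_lt hpr hout))
      · simp [hi]

/-- One production of output followed by a spine: subtrees of the result that have only the
variable `true` and branch at the root are of bounded height. Either they stem from a single
leaf of `t`, or every leaf of `t` below their root has a companion that survives. -/
theorem ZeroOutputTwinned.height_le_of_isSubtree_subst [Finite Q] {ι : Type*}
    (hT : T.ZeroOutputTwinned) (g : GroundTree arS) {M : ℕ}
    (hM : ∀ q a, (T.rhs q a).height ≤ M) {c : VTree arS Bool} (hc : IsSpine c) {i : ι}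
    {t : VTree arD (Q × ι)} (ht : t.height ≤ M)
    (hpair : ∀ u u' q r, u ≠ u' → t.LeafAt u (q, i) → t.LeafAt u' (r, i) → T.OccurPairwise q r)
    {σ : Q × ι → VTree arD (Q × Bool)} (hσ : ∀ q, σ (q, i) = T.stateEval c q)
    (hσ' : ∀ x : Q × ι, x.2 ≠ i → ∃ q, σ x = leaf (q, false)) {B : ℕ}
    (hB : M + M * (Nat.card (Q × Q) + 1) ≤ B)
    (ih : ∀ q, (q, i) ∈ t.vars → ∀ b : VTree arD Q, b.BranchesAtRoot →
      (b.tag true).IsSubtree (T.stateEval c q) → b.height ≤ B)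
    {b : VTree arD Q} (hb : b.BranchesAtRoot) (hbt : (b.tag true).IsSubtree (t.subst σ)) :
    b.height ≤ B := by
  rcases isSubtree_subst hbt with ⟨d, ts, hsub, heq⟩ | ⟨x, hx, hbx⟩
  · cases b with
    | leaf q => simp
    | node d' bs =>
      simp only [tag_node, subst_node, node.injEq] at heq
      obtain ⟨rfl, heq⟩ := heq
      have hbs : ∀ j, (bs j).tag true = (ts j).subst σ := congrFun (eq_of_heq heq)
      -- a child that contains a variable has a leaf whose state survives
      have hlive : ∀ j, (∃ v, v ∈ (bs j).vars) → ∃ r, (r, i) ∈ (ts j).vars ∧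
          ∃ r', (r', true) ∈ (T.stateEval c r).vars := by
        rintro j ⟨v, hv⟩
        rw [← mem_vars_tag (i := true), hbs] at hv
        obtain ⟨⟨r, i'⟩, hr, hvr⟩ := mem_vars_subst.1 hv
        obtain rfl : i' = i := by
          by_contra hne
          obtain ⟨q, hq⟩ := hσ' (r, i') hne
          simp [hq] at hvr
        rw [hσ] at hvr
        exact ⟨r, hr, v, hvr⟩
      obtain ⟨j, j', hne, hj, hj'⟩ := hb
      have hcomp : ∀ m, ∃ n, m ≠ n ∧ ∃ v, v ∈ (bs n).vars := by
        intro m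
        by_cases hm : m = j
        · exact ⟨j', hm ▸ hne, hj'⟩
        · exact ⟨j, hm, hj⟩
      rw [← height_tag true (node d' bs), show (node d' bs).tag true = (node d' ts).subst σ by
        simp [hbs]]
      refine (height_subst_le (n := M * (Nat.card (Q × Q) + 1)) fun x hx => ?_).trans
        ((Nat.add_le_add_right (hsub.height_le.trans ht) _).trans hB)
      obtain ⟨q, i'⟩ := x
      by_cases hi : i' = i
      · subst hi
        obtain ⟨m, hm⟩ := mem_vars_node.1 hx
        obtain ⟨n, hmn, hn⟩ := hcomp m
        obtain ⟨r, hr, hr'⟩ := hlive n hn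
        obtain ⟨u, u', huu, hu, hu'⟩ := hsub.exists_leafAt_ne hmn hm hr
        rw [hσ]
        refine (hT.height_stateEval_le g hM hc (hpair u u' q r huu hu hu') hr').trans ?_
        exact Nat.mul_le_mul_left _ (Nat.succ_le_succ (Set.ncard_le_card _))
      · obtain ⟨q', hq'⟩ := hσ' (q, i') hi
        simp [hq']
  · obtain ⟨q, i'⟩ := x
    by_cases hi : i' = i
    · subst hi
      rw [hσ] at hbx
      exact ih q hx b hb hbx
    · obtain ⟨q', hq'⟩ := hσ' (q, i') hi
      rw [hq', isSubtree_leaf] at hbx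
      rw [← height_tag true, hbx]
      simp

/-- The bound of `height_le_of_isSubtree_subst` for the output of an accessible state. -/
theorem ZeroOutputTwinned.height_le_of_isSubtree_stateEval [Finite Q] (hT : T.ZeroOutputTwinned)
    (g : GroundTree arS) {M : ℕ} (hM : ∀ q a, (T.rhs q a).height ≤ M) {c : VTree arS Bool}
    (hc : IsSpine c) {q : Q}
    (hq : ∃ c₀ : VTree arS (Fin 1), c₀.IsContext ∧ (q, 0) ∈ (T.eval c₀).vars)
    {b : VTree arD Q} (hb : b.BranchesAtRoot) (hbq : (b.tag true).IsSubtree (T.stateEval c q)) :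
    b.height ≤ M + M * (Nat.card (Q × Q) + 1) := by
  induction hc generalizing q b with
  | hole =>
    rw [stateEval_leaf, isSubtree_leaf] at hbq
    rw [← height_tag true, hbq]
    simp
  | node a i hc ih =>
    obtain ⟨c₀, hc₀, hqc₀⟩ := hq
    obtain ⟨w, hw⟩ := mem_vars_iff_leafAt.1 hqc₀
    have hc₁ := hc₀.subst (isContext_stepContext g a i)
    have heval : ∀ u p, (T.rhs q a).LeafAt u (p, i) →
        (T.eval (c₀.subst fun _ => stepContext g a i)).LeafAt (w ++ u) (p, 0) := by
      intro u p hu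
      rw [eval_subst]
      exact hw.subst (leafAt_stateEval_stepContext g hu)
    rw [stateEval_spineNode] at hbq
    refine hT.height_le_of_isSubtree_subst g hM hc (i := i) (hM q a) ?_ (by simp)
      (fun x hx => ⟨x.1, by simp [hx]⟩) le_rfl ?_ hb hbq
    · intro u u' p r hne hu hu'
      exact ⟨_, hc₁, w ++ u, w ++ u', fun h => hne (List.append_cancel_left h),
        heval u p hu, heval u' r hu'⟩
    · intro p hp b' hb' hbp
      obtain ⟨u, hu⟩ := mem_vars_iff_leafAt.1 hp
      exact ih ⟨_, hc₁, mem_vars_iff_leafAt.2 ⟨_, heval u p hu⟩⟩ hb' hbp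

theorem eval_leaf (T : Transducer Q arS arD) (v : V) :
    T.eval (leaf v) = T.init.subst fun p => leaf (p.1, v) := rfl

theorem eval_leaf_zero (T : Transducer Q arS arD) : T.eval (leaf (0 : Fin 1)) = T.init := by
  rw [eval_leaf]
  conv_rhs => rw [← subst_id T.init]
  exact (subst_eq_subst_iff _ _ _).2 fun p _ => by rw [Subsingleton.elim (0 : Fin 1) p.2]

/-! ### The linear transducer -/

/-- The delays of `T`: the subtrees of the trees `T(c)`, `c` a spine, that branch at the root and
whose leaves with a label `q(x)` all process the end of the spine. For lca-conform `T` these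
include the trees `T(c)/ν`, where `ν` is the lowest common ancestor of the leaves that process
the end of `c`. The label `true` is dropped from the leaves. -/
def delays (T : Transducer Q arS arD) : Set (VTree arD Q) :=
  {t | t.BranchesAtRoot ∧ ∃ c, IsSpine c ∧ (t.tag true).IsSubtree (T.eval c)}

theorem ZeroOutputTwinned.finite_delays [Finite Q] [Finite S] [Finite D]
    (hT : T.ZeroOutputTwinned) (g : GroundTree arS) : T.delays.Finite := by
  obtain ⟨M₀, hM₀⟩ := (Set.finite_range fun x : Q × S => (T.rhs x.1 x.2).height).bddAbove
  set M := max M₀ T.init.height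
  have hM : ∀ q a, (T.rhs q a).height ≤ M := fun q a =>
    (hM₀ ⟨(q, a), rfl⟩).trans (le_max_left _ _)
  refine (finite_setOf_height_le (M + M * (Nat.card (Q × Q) + 1))).subset ?_
  rintro b ⟨hb, c, hc, hbc⟩
  refine hT.height_le_of_isSubtree_subst g hM hc (i := (0 : Fin 1)) (le_max_right _ _) ?_
    (fun _ => rfl) (fun x hx => absurd (Subsingleton.elim _ _) hx) le_rfl ?_ hb hbc
  · intro u u' q r hne hu hu'
    rw [← T.eval_leaf_zero] at hu hu'
    exact ⟨leaf 0, isContext_leaf, u, u', hne, hu, hu'⟩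
  · intro q hq b' hb' hbq
    rw [← T.eval_leaf_zero] at hq
    exact hT.height_le_of_isSubtree_stateEval g hM hc ⟨leaf 0, isContext_leaf, hq⟩ hb' hbq

theorem mem_delays_of_isSubtree_init {b : VTree arD Q} {i : Fin 1} (hb : b.BranchesAtRoot)
    (h : (b.tag i).IsSubtree T.init) : b ∈ T.delays := by
  refine ⟨hb, leaf true, .hole, ?_⟩
  have := h.subst fun p => (leaf (p.1, true) : VTree arD (Q × Bool))
  rwa [subst_tag] at this

theorem mem_delays_of_isSubtree_step {t b : VTree arD Q} (ht : t ∈ T.delays) {a : S}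
    {i : Fin (arS a)} (hb : b.BranchesAtRoot)
    (h : (b.tag i).IsSubtree (t.subst fun q => T.rhs q a)) : b ∈ T.delays := by
  obtain ⟨-, c, hc, htc⟩ := ht
  refine ⟨hb, _, hc.extend (.node a i .hole), ?_⟩
  have h1 := h.subst fun p => if p.2 = i then T.stateEval (leaf true) p.1 else leaf (p.1, false)
  have h2 := htc.subst fun p => T.stateEval
    (if p.2 then spineNode a i (leaf true) else leaf false) p.1
  rw [subst_tag] at h2
  rw [subst_tag, subst_subst] at h1
  rw [eval_subst]
  simp only [if_true, stateEval_spineNode] at h1 h2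
  exact h1.trans h2

/-- All leaves of a delay process the end of one input path; if a symbol is appended to this
path, the result is a subtree of `T(s)` for a pattern `s`. -/
theorem LcaConform.separated_step (hT : T.LcaConform) (g : GroundTree arS) {t : VTree arD Q}
    (ht : t ∈ T.delays) (a : S) : (t.subst fun q => T.rhs q a).Separated := by
  obtain ⟨-, c, hc, htc⟩ := ht
  have hs : (c.subst (fill g (node a leaf))).IsPattern := by
    right
    rw [hc.vars_subst_fill]
    simp [vars_node]
  refine (hT.separated_eval hs).of_isSubtree ?_
  have := htc.subst fun p => T.stateEval (fill g (node a leaf) p.2) p.1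
  rw [← eval_subst, subst_tag] at this
  simpa [fill] using this

/-- A transducer `T'` is equivalent to `T` if each of its states stands for a tree of states of
`T`, compatibly with the axioms and the rules. -/
theorem equivalent_of_simulation {T' : Transducer Q' arS arD} (val : Q' → VTree arD Q)
    (hinit : T'.init.subst (fun p => (val p.1).tag p.2) = T.init)
    (hrhs : ∀ q' a, (T'.rhs q' a).subst (fun p => (val p.1).tag p.2) =
      (val q').subst fun q => T.rhs q a) : T.Equivalent T' := by
  have key : ∀ (s : GroundTree arS) q',
      T'.stateOutput s q' = (val q').subst fun q => T.stateOutput s q := by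
    intro s
    induction s with
    | leaf e => exact e.elim
    | node a ts ih =>
      intro q'
      have h1 : T'.stateOutput (node a ts) q' =
          (T'.rhs q' a).subst fun p => T'.stateOutput (ts p.2) p.1 := by
        simp only [stateOutput, stateEval_node, subst_subst]
      have h2 : ∀ q, T.stateOutput (node a ts) q =
          (T.rhs q a).subst fun p => T.stateOutput (ts p.2) p.1 := fun q => by
        simp only [stateOutput, stateEval_node, subst_subst]
      simp only [h1, h2, ih]
      rw [← subst_subst (val q'), ← hrhs, subst_subst]
      simp only [subst_tag]
  intro s
  have h1 : T.output s = T.init.subst fun p => T.stateOutput s p.1 := by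
    simp only [output, eval, subst_subst, stateOutput]
  have h2 : T'.output s = T'.init.subst fun p => T'.stateOutput s p.1 := by
    simp only [output, eval, subst_subst, stateOutput]
  rw [h1, h2, ← hinit, subst_subst]
  simp only [subst_tag, key]

theorem exists_linear_equivalent [Finite Q] [Finite S] [Finite D] (hz : T.ZeroOutputTwinned)
    (hl : T.LcaConform) (g : GroundTree arS) :
    ∃ (n : ℕ) (T' : Transducer (Fin n) arS arD), T'.IsLinear ∧ T.Equivalent T' := by
  obtain ⟨n, f, hf⟩ := (hz.finite_delays g).fin_embedding
  have hmem : ∀ x, f x ∈ T.delays := fun x => hf ▸ Set.mem_range_self x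
  have hval : ∀ b ∈ T.delays, ∃ x, f x = b := fun b hb => by rwa [← hf] at hb
  have hinit : T.init.Separated := by
    rw [← T.eval_leaf_zero]
    exact hl.separated_eval isContext_leaf.1
  obtain ⟨init, hi, hin, -⟩ := hinit.exists_linear (val := f)
    fun b i hb h => hval b (mem_delays_of_isSubtree_init hb h)
  have := fun x a => (hl.separated_step g (hmem x) a).exists_linear (val := f)
    fun b i hb h => hval b (mem_delays_of_isSubtree_step (hmem x) hb h)
  choose rhs hr hrn _ using this
  exact ⟨n, ⟨init, rhs⟩, ⟨hin, hrn⟩, equivalent_of_simulation f hi hr⟩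

/-- Without ground input trees, every transducer is equivalent to the one that only copies a
state to the first child; all symbols have positive rank in this case. -/
theorem exists_linear_of_isEmpty (T : Transducer Q arS arD) (h : IsEmpty (GroundTree arS)) :
    ∃ T' : Transducer Unit arS arD, T'.IsLinear ∧ T.Equivalent T' := by
  have hpos : ∀ a, 0 < arS a := fun a => Nat.pos_of_ne_zero fun h0 =>
    h.elim (node a fun i => absurd i.2 (by omega))
  exact ⟨⟨leaf ((), 0), fun _ a => leaf ((), ⟨0, hpos a⟩)⟩,
    ⟨by simp, fun _ _ => by simp⟩, fun s => h.elim s⟩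

end Transducer

theorem theorem1 {Q S D : Type*} [Finite Q] [Finite S] [Finite D] (arS : S → ℕ) (arD : D → ℕ)
    (T : Transducer Q arS arD) (hT : T.IsCanonicalEarliest) :
    (∃ (Q' : Type) (_ : Finite Q') (T' : Transducer Q' arS arD), T'.IsLinear ∧ T.Equivalent T') ↔
      T.ZeroOutputTwinned ∧ T.LcaConform := by
  constructor
  · rintro ⟨Q', _, T', hlin, he⟩
    exact ⟨hT.zeroOutputTwinned_of_equivalent hlin he, hT.1.lcaConform_of_equivalent hlin he⟩
  · rintro ⟨hz, hl⟩
    rcases isEmpty_or_nonempty (GroundTree arS) with h | ⟨⟨g⟩⟩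
    · obtain ⟨T', h'⟩ := T.exists_linear_of_isEmpty h
      exact ⟨Unit, inferInstance, T', h'⟩
    · obtain ⟨n, T', h'⟩ := T.exists_linear_equivalent hz hl g
      exact ⟨Fin n, inferInstance, T', h'⟩
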